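/- For positive integers $k,n$ let $$\Phi_k(n)=\#\{(x_1,\dots,x_k)\in(\mathbb Z/n\mathbb Z)^k:\ \gcd(x_1^2+\cdots+x_k^2,\,n)=1\}.$$ Then, for real $x\to\infty$, $$\sum_{1\le n\le x}\Phi_2(n)=\frac{x^3}{4}\prod_{p\equiv 1\ (\mathrm{mod}\ 4)}\left(1-\frac{2}{p^2}+\frac1{p^3}\right)\prod_{p\equiv -1\ (\mathrm{mod}\ 4)}\left(1-\frac1{p^3}\right)+O(x^2\log x)$$ and $$\sum_{1\le n\le x}\Phi_4(n)=\frac{3x^5}{20}\prod_{p>2}\left(1-\frac1{p^2}-\frac1{p^3}+\frac1{p^4}\right)+O(x^4\log x),$$ where the products run over the primes $p$ satisfying the indicated conditions and converge unconditionally, and the implied constants are absolute. -/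

import Mathlib

open Asymptotics Filter

/-- `sumSqTotient k n` is `Φ_k(n)`, the number of `k`-tuples `(x₁, …, x_k)` of residue classes
modulo `n` such that `gcd (x₁² + ⋯ + x_k², n) = 1`. The gcd is taken with the least nonnegative
representative of the class `x₁² + ⋯ + x_k²`. Only `n ≥ 1` is meaningful. -/
noncomputable def sumSqTotient (k n : ℕ) : ℕ :=
  Nat.card {x : Fin k → ZMod n // Nat.gcd (∑ i, x i ^ 2).val n = 1}

/-! By the Chinese remainder theorem and reduction mod `p`, Φ_k(n) = n^k ∏_{p ∣ n} (1 + g(p)), where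
1 + g(p) is the density of unit sums of k squares mod `p`. The product equals ∑_{d ∣ n} G(d), with G
multiplicative, supported on squarefree numbers and extending g. Summing n^k ∑_{d ∣ n} G(d) over n ≤
x gives x^(k+1)/(k+1) · ∑ G(d)/d, an Euler product, with error O(x^k log x) once ∑_{d ≤ N} |G(d)| =
O(log N) (`sum_pow_mul_sum_divisors_isBigO`, `sumSqTotient_mean_value`).

That bound comes from a multiplicative majorant compared with |g| at primes only. For k = 4, |g(p)|
≤ 1/p + 1/p², and the convolution of 1/n and 1/n² suffices. For k = 2, g(p) is about -2/p when p ≡ 1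
mod 4 but -1/p² when p ≡ 3 mod 4; using 2/p throughout would cost a second logarithm. Convolving
further with χ₄(n)/n gives (1 + χ₄(p))/p + 1/p² at primes, and the bounded partial sums of χ₄(n)/n
keep a single logarithm. -/

/-! ### Power sums, tails and mean values of divisor sums -/

lemma sum_pow_sub_abs_le (k : ℕ) {y : ℝ} (hy : 0 ≤ y) :
    |∑ m ∈ Finset.Ioc 0 ⌊y⌋₊, (m : ℝ) ^ k - y ^ (k + 1) / (k + 1)| ≤ y ^ k := by
  -- The integral of t^k over [a, b] lies between its endpoint rectangles. This is used on unit
  -- intervals and on the last interval from ⌊y⌋ to y.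
  have key : ∀ {a b : ℝ}, 0 ≤ a → a ≤ b →
      (b - a) * a ^ k ≤ (b ^ (k + 1) - a ^ (k + 1)) / (k + 1) ∧
        (b ^ (k + 1) - a ^ (k + 1)) / (k + 1) ≤ (b - a) * b ^ k := by
    intro a b ha hab
    have hb := ha.trans hab
    have hk : (0 : ℝ) < k + 1 := by positivity
    rw [le_div_iff₀ hk, div_le_iff₀ hk, ← (Commute.all b a).mul_geom_sum₂, mul_assoc, mul_assoc]
    have hc : (∑ _i ∈ Finset.range (k + 1), a ^ k) = a ^ k * (k + 1) := by
      simp [mul_comm]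
    have hd : (∑ _i ∈ Finset.range (k + 1), b ^ k) = b ^ k * (k + 1) := by
      simp [mul_comm]
    rw [← hc, ← hd]
    have hba : 0 ≤ b - a := by linarith
    refine ⟨mul_le_mul_of_nonneg_left (Finset.sum_le_sum fun i hi ↦ ?_) hba,
      mul_le_mul_of_nonneg_left (Finset.sum_le_sum fun i hi ↦ ?_) hba⟩
    all_goals
      obtain ⟨j, rfl⟩ := Nat.exists_eq_add_of_le (Nat.lt_succ_iff.1 (Finset.mem_range.1 hi))
      rw [show i + j + 1 - 1 - i = j by omega, pow_add]
      gcongr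
  have hM : ∀ M : ℕ, (M : ℝ) ^ (k + 1) / (k + 1) ≤ ∑ m ∈ Finset.Ioc 0 M, (m : ℝ) ^ k ∧
      ∑ m ∈ Finset.Ioc 0 M, (m : ℝ) ^ k ≤ (M : ℝ) ^ (k + 1) / (k + 1) + (M : ℝ) ^ k := by
    intro M
    induction M with
    | zero => simp
    | succ M ih =>
      rw [Finset.sum_Ioc_succ_top (Nat.zero_le M)]
      have := key (a := M) (b := (M + 1 : ℕ)) (by positivity) (by push_cast; linarith)
      have h1 : ((M + 1 : ℕ) : ℝ) - M = 1 := by push_cast; ring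
      rw [h1, one_mul, one_mul, sub_div] at this
      constructor <;> linarith [ih.1, ih.2]
  obtain ⟨h1, h2⟩ := hM ⌊y⌋₊
  have hf := Nat.floor_le hy
  have hf' := Nat.lt_floor_add_one y
  obtain ⟨h3, h4⟩ := key (Nat.cast_nonneg ⌊y⌋₊) hf
  rw [sub_div] at h3 h4
  have h5 : (y - ⌊y⌋₊) * y ^ k ≤ y ^ k :=
    mul_le_of_le_one_left (by positivity) (by linarith)
  have h6 : (⌊y⌋₊ : ℝ) ^ k ≤ y ^ k := by gcongr
  have h7 : 0 ≤ (y - ⌊y⌋₊) * (⌊y⌋₊ : ℝ) ^ k := mul_nonneg (by linarith) (by positivity)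
  rw [abs_le]
  constructor <;> linarith

/-- A telescoping form of partial summation: a logarithmic bound for the partial sums of `a`
controls the tails of `∑ a d / d`. -/
lemma sum_Ioc_div_le {a : ℕ → ℝ} {C : ℝ}
    (hC : ∀ N : ℕ, 1 ≤ N → ∑ d ∈ Finset.Ioc 0 N, a d ≤ C * (1 + Real.log N))
    (ha : ∀ n, 0 ≤ a n) {N M : ℕ} (hNM : N ≤ M) :
    ∑ d ∈ Finset.Ioc N M, a d / d ≤ C * ((2 + Real.log (N + 1)) / (N + 1)) := by
  have hC0 : 0 ≤ C := by
    have := hC 1 le_rfl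
    have h1 : 0 ≤ ∑ d ∈ Finset.Ioc 0 1, a d := Finset.sum_nonneg fun i _ ↦ ha i
    simp at this h1; linarith
  -- The first term is the Abel boundary term. The function (2 + log t)/t has derivative -(1 + log
  -- t)/t², so its decrements absorb the growth of the partial sums; its value at M + 1 finally
  -- absorbs the boundary term.
  have main : ∑ d ∈ Finset.Ioc N M, a d / d ≤ (∑ d ∈ Finset.Ioc 0 M, a d) / (M + 1) +
      C * ((2 + Real.log (N + 1)) / (N + 1)) - C * ((2 + Real.log (M + 1)) / (M + 1)) := by
    induction M, hNM using Nat.le_induction with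
    | base =>
      have : 0 ≤ (∑ d ∈ Finset.Ioc 0 N, a d) / (N + 1) :=
        div_nonneg (Finset.sum_nonneg fun i _ ↦ ha i) (by positivity)
      simpa using this
    | succ M hNM ih =>
      rw [Finset.sum_Ioc_succ_top hNM, Finset.sum_Ioc_succ_top (Nat.zero_le M)]
      have hT := hC (M + 1) (by omega)
      rw [Finset.sum_Ioc_succ_top (Nat.zero_le M)] at hT
      push_cast at hT ⊢
      set T := ∑ d ∈ Finset.Ioc 0 M, a d
      set t : ℝ := (M : ℝ) + 1 with ht
      have ht0 : 1 ≤ t := by simp [ht]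
      have hlog : Real.log (t + 1) ≤ Real.log t + 1 / t := by
        have h := Real.log_le_sub_one_of_pos (x := (t + 1) / t) (by positivity)
        rw [Real.log_div (by positivity) (by positivity)] at h
        have : (t + 1) / t - 1 = 1 / t := by field_simp; ring
        linarith
      have e1 : a (M + 1) / t - (T + a (M + 1)) / (t + 1) + T / t =
          (T + a (M + 1)) / (t * (t + 1)) := by field_simp; ring
      have e2 : (T + a (M + 1)) / (t * (t + 1)) ≤ C * (1 + Real.log t) / (t * (t + 1)) := by
        gcongr
      have e3 : C * (1 + Real.log t) / (t * (t + 1)) ≤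
          C * ((2 + Real.log t) / t) - C * ((2 + Real.log (t + 1)) / (t + 1)) := by
        rw [mul_div_assoc, ← mul_sub]
        refine mul_le_mul_of_nonneg_left ?_ hC0
        have : (2 + Real.log (t + 1)) / (t + 1) ≤ (2 + (Real.log t + 1 / t)) / (t + 1) := by
          gcongr
        have e4 : (2 + Real.log t) / t - (2 + (Real.log t + 1 / t)) / (t + 1) =
          (1 + Real.log t) / (t * (t + 1)) := by field_simp; ring
        linarith
      linarith
  have hM : (∑ d ∈ Finset.Ioc 0 M, a d) / (M + 1) ≤ C * ((2 + Real.log (M + 1)) / (M + 1)) := by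
    rw [← mul_div_assoc]
    gcongr
    rcases Nat.eq_zero_or_pos M with rfl | hM
    · simp; positivity
    · refine (hC M hM).trans (mul_le_mul_of_nonneg_left ?_ hC0)
      have : Real.log M ≤ Real.log (M + 1) := Real.log_le_log (by exact_mod_cast hM) (by linarith)
      linarith
  linarith

lemma summable_abs_div_of_sum_le {G : ℕ → ℝ} {C : ℝ}
    (hC : ∀ N : ℕ, 1 ≤ N → ∑ d ∈ Finset.Ioc 0 N, |G d| ≤ C * (1 + Real.log N)) :
    Summable fun d : ℕ ↦ |G d| / d := by
  refine summable_of_sum_range_le (c := C * ((2 + Real.log ((0 : ℕ) + 1)) / ((0 : ℕ) + 1)))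
    (fun n ↦ by positivity) fun n ↦ ?_
  refine le_trans ?_ (sum_Ioc_div_le hC (fun n ↦ abs_nonneg _) (Nat.zero_le n))
  -- The index 0 contributes nothing, since division by zero gives 0.
  rw [Finset.sum_subset (s₁ := Finset.Ioc 0 n) (s₂ := Finset.range (n + 1))]
  · exact Finset.sum_le_sum_of_subset_of_nonneg (by intro; simp; omega) fun _ _ _ ↦ by positivity
  · intro; simp
  · intro i hi h
    have : i = 0 := by simp at hi h; omega
    simp [this]

lemma abs_tail_le {G : ℕ → ℝ} {C : ℝ}
    (hC : ∀ N : ℕ, 1 ≤ N → ∑ d ∈ Finset.Ioc 0 N, |G d| ≤ C * (1 + Real.log N)) (N : ℕ) :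
    |∑' d : ℕ, G d / d - ∑ d ∈ Finset.Ioc 0 N, G d / d| ≤
      C * ((2 + Real.log (N + 1)) / (N + 1)) := by
  have hs : Summable fun d : ℕ ↦ G d / d := by
    refine Summable.of_norm ((summable_abs_div_of_sum_le hC).congr fun d ↦ ?_)
    simp
  have ht : Tendsto (fun M ↦ |∑ d ∈ Finset.range (M + 1), G d / d -
      ∑ d ∈ Finset.Ioc 0 N, G d / d|) atTop
      (nhds |∑' d : ℕ, G d / d - ∑ d ∈ Finset.Ioc 0 N, G d / d|) :=
    (((tendsto_add_atTop_iff_nat 1).2 hs.hasSum.tendsto_sum_nat).sub_const _).abs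
  refine le_of_tendsto ht (eventually_atTop.2 ⟨N, fun M hM ↦ ?_⟩)
  have h0 : ∑ d ∈ Finset.range (M + 1), G d / d = ∑ d ∈ Finset.Ioc 0 M, G d / d := by
    symm
    refine Finset.sum_subset (fun i ↦ by simp) fun i hi h ↦ ?_
    have : i = 0 := by simp at hi h; omega
    simp [this]
  rw [h0, ← Finset.sum_Ioc_consecutive _ (Nat.zero_le N) hM, add_sub_cancel_left]
  refine (Finset.abs_sum_le_sum_abs _ _).trans ?_
  refine le_trans (le_of_eq (Finset.sum_congr rfl fun d _ ↦ ?_))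
    (sum_Ioc_div_le hC (fun n ↦ abs_nonneg _) hM)
  simp [abs_div]

/-- The mean value of `n ^ k * ∑_{d ∣ n} G d` when `∑_{d ≤ N} |G d|` grows logarithmically. -/
theorem sum_pow_mul_sum_divisors_isBigO (k : ℕ) {G : ℕ → ℝ} {C : ℝ}
    (hC : ∀ N : ℕ, 1 ≤ N → ∑ d ∈ Finset.Ioc 0 N, |G d| ≤ C * (1 + Real.log N)) :
    (fun x : ℝ ↦ ∑ n ∈ Finset.Icc 1 ⌊x⌋₊, (n : ℝ) ^ k * ∑ d ∈ n.divisors, G d -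
      x ^ (k + 1) / (k + 1) * ∑' d : ℕ, G d / d) =O[atTop]
      (fun x : ℝ ↦ x ^ k * Real.log x) := by
  -- For x ≥ e, so that log x ≥ 1, the sum over d ≤ x costs C(1 + log x) and the tail C(3 + log x),
  -- together at most 6C log x; the 7 leaves slack.
  refine IsBigO.of_bound (7 * C) ?_
  filter_upwards [eventually_ge_atTop (Real.exp 1)] with x hx
  have hx1 : 1 ≤ x := le_trans (by simp) hx
  have hx0 : 0 < x := by linarith
  have hlog : 1 ≤ Real.log x := by rwa [Real.le_log_iff_exp_le hx0]
  set N := ⌊x⌋₊ with hN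
  have hN1 : 1 ≤ N := (Nat.one_le_floor_iff x).2 hx1
  have hNx : (N : ℝ) ≤ x := Nat.floor_le hx0.le
  have hxN : x < N + 1 := Nat.lt_floor_add_one x
  have hC0 : 0 ≤ C := by
    have := hC 1 le_rfl
    simp at this; exact (abs_nonneg _).trans this
  -- The Dirichlet product `H * P` is n^k ∑_{d ∣ n} G(d). The value at 0 is forced by hand because
  -- 0^0 = 1 and `G 0` is arbitrary.
  let P : ArithmeticFunction ℝ := ⟨fun n ↦ if n = 0 then 0 else (n : ℝ) ^ k, by simp⟩
  let H : ArithmeticFunction ℝ := ⟨fun n ↦ if n = 0 then 0 else (n : ℝ) ^ k * G n, by simp⟩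
  have e1 : ∑ n ∈ Finset.Icc 1 N, (n : ℝ) ^ k * ∑ d ∈ n.divisors, G d =
      ∑ d ∈ Finset.Ioc 0 N, (d : ℝ) ^ k * G d * ∑ m ∈ Finset.Ioc 0 ⌊x / d⌋₊, (m : ℝ) ^ k := by
    calc _ = ∑ n ∈ Finset.Ioc 0 N, (H * P) n := by
            refine Finset.sum_congr (by ext; simp; omega) fun n hn ↦ ?_
            rw [ArithmeticFunction.mul_apply, Nat.sum_divisorsAntidiagonal
              (f := fun a b ↦ H a * P b), Finset.mul_sum]
            refine Finset.sum_congr rfl fun d hd ↦ ?_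
            have hdn := Nat.dvd_of_mem_divisors hd
            have hn0 : n ≠ 0 := by simp at hn; omega
            have hd0 : d ≠ 0 := by rintro rfl; simp at hdn; omega
            have hq : n / d ≠ 0 := by
              have := Nat.div_pos (Nat.le_of_dvd (by omega) hdn) (by omega); omega
            have : (n : ℝ) = d * (n / d : ℕ) := by
              rw [← Nat.cast_mul, Nat.mul_div_cancel' hdn]
            simp only [H, P, ArithmeticFunction.coe_mk, if_neg hd0, if_neg hq]
            rw [this]; ring
      _ = _ := by
            rw [ArithmeticFunction.sum_Ioc_mul_eq_sum_sum]
            refine Finset.sum_congr rfl fun d hd ↦ ?_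
            have hd0 : d ≠ 0 := by simp at hd; omega
            rw [Nat.floor_div_natCast, ← hN]
            simp only [H, P, ArithmeticFunction.coe_mk, if_neg hd0]
            congr 1
            refine Finset.sum_congr rfl fun m hm ↦ ?_
            rw [if_neg (by simp at hm; omega)]
  have e2 : x ^ (k + 1) / (k + 1) * ∑ d ∈ Finset.Ioc 0 N, G d / d =
      ∑ d ∈ Finset.Ioc 0 N, (d : ℝ) ^ k * G d * ((x / d) ^ (k + 1) / (k + 1)) := by
    rw [Finset.mul_sum]
    refine Finset.sum_congr rfl fun d hd ↦ ?_
    have hd0 : (d : ℝ) ≠ 0 := by simp at hd; norm_cast; omega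
    rw [div_pow]
    field_simp
    ring
  have e3 : |∑ n ∈ Finset.Icc 1 N, (n : ℝ) ^ k * ∑ d ∈ n.divisors, G d -
      x ^ (k + 1) / (k + 1) * ∑ d ∈ Finset.Ioc 0 N, G d / d| ≤ x ^ k * (C * (1 + Real.log N)) := by
    rw [e1, e2, ← Finset.sum_sub_distrib]
    refine (Finset.abs_sum_le_sum_abs _ _).trans ?_
    refine le_trans (Finset.sum_le_sum (g := fun d ↦ x ^ k * |G d|) fun d hd ↦ ?_) ?_
    · have hd0 : (d : ℝ) ≠ 0 := by simp at hd; norm_cast; omega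
      rw [← mul_sub, abs_mul, abs_mul, abs_of_nonneg (by positivity : (0 : ℝ) ≤ (d : ℝ) ^ k)]
      refine (mul_le_mul_of_nonneg_left (sum_pow_sub_abs_le k (by positivity))
        (by positivity)).trans (le_of_eq ?_)
      rw [div_pow]
      field_simp
    · rw [← Finset.mul_sum]
      exact mul_le_mul_of_nonneg_left (hC N hN1) (by positivity)
  have e4 := abs_tail_le hC N
  have hlogN : Real.log N ≤ Real.log x := Real.log_le_log (by exact_mod_cast hN1) hNx
  have hlogN1 : Real.log (N + 1) ≤ Real.log x + 1 := by
    have h2 : Real.log (N + 1) ≤ Real.log (2 * x) :=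
      Real.log_le_log (by positivity) (by linarith)
    rw [Real.log_mul (by norm_num) hx0.ne'] at h2
    linarith [Real.log_two_lt_d9]
  have e5 : C * ((2 + Real.log (N + 1)) / (N + 1)) ≤ C * ((3 + Real.log x) / x) := by
    gcongr ?_ * ?_
    gcongr ?_ / ?_
    linarith
  have e6 : x ^ (k + 1) / (k + 1) * (C * ((3 + Real.log x) / x)) ≤
      x ^ k * (C * (3 + Real.log x)) := by
    have : x ^ (k + 1) / (k + 1) * (C * ((3 + Real.log x) / x)) =
      x ^ k * (C * (3 + Real.log x)) / (k + 1) := by field_simp; ring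
    rw [this]
    exact div_le_self (by positivity) (by linarith [(Nat.cast_nonneg k : (0 : ℝ) ≤ k)])
  have e7 : |x ^ (k + 1) / (k + 1) * (∑' d : ℕ, G d / d - ∑ d ∈ Finset.Ioc 0 N, G d / d)| ≤
      x ^ k * (C * (3 + Real.log x)) := by
    rw [abs_mul, abs_of_nonneg (by positivity : 0 ≤ x ^ (k + 1) / ((k : ℝ) + 1))]
    exact (mul_le_mul_of_nonneg_left (e4.trans e5) (by positivity)).trans e6
  have e8 : x ^ k * (C * (1 + Real.log N)) ≤ x ^ k * (C * (1 + Real.log x)) := by gcongr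
  have e9 : x ^ k * C * 1 ≤ x ^ k * C * Real.log x := by gcongr
  rw [Real.norm_eq_abs, Real.norm_eq_abs, abs_of_nonneg (a := x ^ k * Real.log x) (by positivity)]
  rw [abs_le] at *
  constructor <;> nlinarith [e3.1, e3.2, e7.1, e7.2]

/-! ### Local densities of unit sums of squares -/

/-- The proportion of vectors in `R ^ k` whose sum of squares is a unit. -/
noncomputable def unitSumSqDensity (k : ℕ) (R : Type*) [CommRing R] : ℝ :=
  (Nat.card {x : Fin k → R // IsUnit (∑ i, x i ^ 2)} : ℝ) / (Nat.card R : ℝ) ^ k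

lemma sumSqTotient_eq (k : ℕ) {n : ℕ} (hn : n ≠ 0) :
    (sumSqTotient k n : ℝ) = (n : ℝ) ^ k * unitSumSqDensity k (ZMod n) := by
  have : NeZero n := ⟨hn⟩
  rw [unitSumSqDensity, Nat.card_zmod, mul_div_cancel₀ _ (by positivity), sumSqTotient]
  congr 1
  refine Nat.card_congr (Equiv.subtypeEquivRight fun x ↦ ?_)
  rw [← Nat.coprime_iff_gcd_eq_one, ← ZMod.isUnit_iff_coprime, ZMod.natCast_zmod_val]

lemma unitSumSqDensity_prod (k : ℕ) (R S : Type*) [CommRing R] [CommRing S] :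
    unitSumSqDensity k (R × S) = unitSumSqDensity k R * unitSumSqDensity k S := by
  have e : {x : Fin k → R × S // IsUnit (∑ i, x i ^ 2)} ≃
      {x : Fin k → R // IsUnit (∑ i, x i ^ 2)} × {x : Fin k → S // IsUnit (∑ i, x i ^ 2)} :=
    ((Equiv.arrowProdEquivProdArrow (Fin k) (fun _ ↦ R) (fun _ ↦ S)).subtypeEquiv
      (q := fun y ↦ IsUnit (∑ i, y.1 i ^ 2) ∧ IsUnit (∑ i, y.2 i ^ 2)) fun x ↦ by
        simp [Prod.isUnit_iff, Prod.fst_sum, Prod.snd_sum]).trans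
      (Equiv.subtypeProdEquivProd
        (p := fun y : Fin k → R ↦ IsUnit (∑ i, y i ^ 2))
        (q := fun y : Fin k → S ↦ IsUnit (∑ i, y i ^ 2)))
  simp only [unitSumSqDensity, Nat.card_congr e, Nat.card_prod, Nat.cast_mul, mul_pow]
  rw [mul_div_mul_comm]

lemma unitSumSqDensity_congr (k : ℕ) {R S : Type*} [CommRing R] [CommRing S] (e : R ≃+* S) :
    unitSumSqDensity k R = unitSumSqDensity k S := by
  have e' : {x : Fin k → R // IsUnit (∑ i, x i ^ 2)} ≃
      {x : Fin k → S // IsUnit (∑ i, x i ^ 2)} :=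
    ((Equiv.refl (Fin k)).arrowCongr e.toEquiv).subtypeEquiv fun x ↦ by
      rw [← MulEquiv.isUnit_map e]
      simp
  simp only [unitSumSqDensity, Nat.card_congr e', Nat.card_congr e.toEquiv]

/-- Every fibre of a surjective homomorphism has as many elements as the kernel. Counting with `p`
and with the trivial predicate eliminates the kernel. -/
lemma card_preimage_mul_card {G H : Type*} [AddGroup G] [AddGroup H] [Finite G]
    (f : G →+ H) (hf : Function.Surjective f) (p : H → Prop) :
    Nat.card {x // p (f x)} * Nat.card H = Nat.card {y // p y} * Nat.card G := by
  have e : ∀ q : H → Prop, Nat.card {x // q (f x)} = Nat.card {y // q y} * Nat.card f.ker := by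
    intro q
    rw [← Nat.card_prod]
    let s := Function.surjInv hf
    have hs : ∀ y, f (s y) = y := Function.surjInv_eq hf
    refine Nat.card_congr
      ⟨fun x ↦ (⟨f x, x.2⟩, ⟨x - s (f x), by simp [AddMonoidHom.mem_ker, hs]⟩),
        fun y ↦ ⟨y.2 + s y.1, ?_⟩, fun x ↦ by simp, fun y ↦ ?_⟩
    · have := AddMonoidHom.mem_ker.1 y.2.2
      simpa [this, hs] using y.1.2
    · have := AddMonoidHom.mem_ker.1 y.2.2
      ext <;> simp [this, hs]
  have h1 := e p
  have h2 := e fun _ ↦ True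
  simp only [Nat.card_congr (Equiv.subtypeUnivEquiv fun _ : G ↦ trivial),
    Nat.card_congr (Equiv.subtypeUnivEquiv fun _ : H ↦ trivial)] at h2
  rw [h1, h2]; ring

/-- Applying `f` in each coordinate has fibres of constant size, and `f` detects units. This reduces
modulus p^a to modulus p. -/
lemma unitSumSqDensity_of_surjective (k : ℕ) {R S : Type*} [CommRing R] [CommRing S] [Finite R]
    (f : R →+* S) (hf : Function.Surjective f) (hu : ∀ a, IsUnit (f a) ↔ IsUnit a) :
    unitSumSqDensity k R = unitSumSqDensity k S := by
  have : Finite S := Finite.of_surjective f hf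
  have h := card_preimage_mul_card (f.toAddMonoidHom.compLeft (Fin k)) hf.comp_left
    fun y ↦ IsUnit (∑ i, y i ^ 2)
  have h' : Nat.card {x : Fin k → R // IsUnit (∑ i, (f.toAddMonoidHom.compLeft (Fin k) x) i ^ 2)} =
      Nat.card {x : Fin k → R // IsUnit (∑ i, x i ^ 2)} :=
    Nat.card_congr (Equiv.subtypeEquivRight fun x ↦ by rw [← hu]; simp)
  rw [h', Nat.card_fun, Nat.card_fun, Nat.card_fin] at h
  have hR : (Nat.card R : ℝ) ≠ 0 := by exact_mod_cast Nat.card_pos.ne'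
  have hS : (Nat.card S : ℝ) ≠ 0 := by exact_mod_cast Nat.card_pos.ne'
  rw [unitSumSqDensity, unitSumSqDensity, div_eq_div_iff (by positivity) (by positivity)]
  exact_mod_cast h

lemma unitSumSqDensity_zmod_prime_pow (k : ℕ) {p a : ℕ} (hp : p.Prime) (ha : a ≠ 0) :
    unitSumSqDensity k (ZMod (p ^ a)) = unitSumSqDensity k (ZMod p) := by
  have : NeZero (p ^ a) := ⟨pow_ne_zero _ hp.ne_zero⟩
  have : NeZero p := ⟨hp.ne_zero⟩
  refine unitSumSqDensity_of_surjective k (ZMod.castHom (dvd_pow_self p ha) (ZMod p))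
    (ZMod.castHom_surjective _) fun x ↦ ?_
  obtain ⟨m, rfl⟩ := ZMod.natCast_zmod_surjective x
  rw [map_natCast, ZMod.isUnit_iff_coprime, ZMod.isUnit_iff_coprime,
    Nat.coprime_pow_right_iff (Nat.pos_of_ne_zero ha)]

lemma unitSumSqDensity_zmod (k : ℕ) {n : ℕ} (hn : n ≠ 0) :
    unitSumSqDensity k (ZMod n) = ∏ p ∈ n.primeFactors, unitSumSqDensity k (ZMod p) := by
  induction n using Nat.recOnPosPrimePosCoprime with
  | zero => simp at hn
  | one =>
    rw [unitSumSqDensity, Nat.card_congr (Equiv.subtypeUnivEquiv fun _ ↦ isUnit_of_subsingleton _)]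
    simp
  | prime_pow p a hp ha =>
    rw [unitSumSqDensity_zmod_prime_pow k hp ha.ne', Nat.primeFactors_prime_pow ha.ne' hp,
      Finset.prod_singleton]
  | coprime a b ha hb hab iha ihb =>
    rw [unitSumSqDensity_congr k (ZMod.chineseRemainder hab), unitSumSqDensity_prod,
      iha (by omega), ihb (by omega), hab.primeFactors_mul,
      Finset.prod_union hab.disjoint_primeFactors]

lemma unitSumSqDensity_two_zmod_two : unitSumSqDensity 2 (ZMod 2) = 1 / 2 := by
  have : Nat.card {x : Fin 2 → ZMod 2 // ∑ i, x i ^ 2 ≠ 0} = 2 := by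
    rw [Nat.card_eq_fintype_card]; decide
  simp only [unitSumSqDensity, isUnit_iff_ne_zero, this, Nat.card_zmod]
  norm_num

lemma unitSumSqDensity_four_zmod_two : unitSumSqDensity 4 (ZMod 2) = 1 / 2 := by
  have : Nat.card {x : Fin 4 → ZMod 2 // ∑ i, x i ^ 2 ≠ 0} = 8 := by
    rw [Nat.card_eq_fintype_card]; decide
  simp only [unitSumSqDensity, isUnit_iff_ne_zero, this, Nat.card_zmod]
  norm_num

/-- With i² = -1 the form splits as (x + iy)(x - iy), and since 2 ≠ 0 the two factors are
independent coordinates, each of which must be a unit. -/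
lemma unitSumSqDensity_two_of_isSquare {F : Type*} [Field F] [Finite F] (h2 : (2 : F) ≠ 0)
    (h : IsSquare (-1 : F)) : unitSumSqDensity 2 F = (1 - 1 / (Nat.card F : ℝ)) ^ 2 := by
  obtain ⟨i, hi⟩ := h
  have hi0 : i ≠ 0 := by rintro rfl; simp at hi
  let e : {x : Fin 2 → F // IsUnit (∑ j, x j ^ 2)} ≃ Fˣ × Fˣ :=
    { toFun x :=
        have h : IsUnit ((x.1 0 + i * x.1 1) * (x.1 0 - i * x.1 1)) := by
          have := x.2
          rw [Fin.sum_univ_two] at this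
          convert this using 1
          linear_combination x.1 1 ^ 2 * hi
        ((isUnit_of_mul_isUnit_left h).unit, (isUnit_of_mul_isUnit_right h).unit)
      invFun y := ⟨![(y.1 + y.2) / 2, (y.1 - y.2) / (2 * i)], by
        rw [Fin.sum_univ_two]
        have : (![((y.1 : F) + y.2) / 2, (y.1 - y.2) / (2 * i)] 0) ^ 2 +
            (![((y.1 : F) + y.2) / 2, (y.1 - y.2) / (2 * i)] 1) ^ 2 = y.1 * y.2 := by
          have hi' : i ^ 2 = -1 := by rw [hi]; ring
          simp only [Matrix.cons_val_zero, Matrix.cons_val_one, div_pow, mul_pow, hi']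
          field_simp
          ring
        rw [this]
        exact (y.1 * y.2).isUnit⟩
      left_inv x := by
        ext j
        fin_cases j <;> simp <;> field_simp <;> ring
      right_inv y := by
        ext <;> simp <;> field_simp <;> ring }
  have hc : (Nat.card Fˣ : ℝ) = Nat.card F - 1 := by
    rw [Nat.card_units, Nat.cast_sub Nat.card_pos, Nat.cast_one]
  have hF : (Nat.card F : ℝ) ≠ 0 := by exact_mod_cast Nat.card_pos.ne'
  rw [unitSumSqDensity, Nat.card_congr e, Nat.card_prod, Nat.cast_mul, hc]
  field_simp

/-- The form x² + y² is anisotropic here, so only the zero vector is excluded. -/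
lemma unitSumSqDensity_two_of_not_isSquare {F : Type*} [Field F] [Finite F]
    (h : ¬ IsSquare (-1 : F)) : unitSumSqDensity 2 F = 1 - 1 / (Nat.card F : ℝ) ^ 2 := by
  have hz : ∀ x : Fin 2 → F, IsUnit (∑ j, x j ^ 2) ↔ x ≠ 0 := by
    intro x
    rw [isUnit_iff_ne_zero, not_iff_not, Fin.sum_univ_two]
    refine ⟨fun hx ↦ ?_, fun hx ↦ by simp [hx]⟩
    have h1 : x 1 = 0 := by
      by_contra h1
      refine h ⟨x 0 / x 1, ?_⟩
      field_simp
      linear_combination -hx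
    have h0 : x 0 = 0 := by simpa [h1] using hx
    ext j
    fin_cases j <;> simp [h0, h1]
  have hF : (Nat.card F : ℝ) ≠ 0 := by exact_mod_cast Nat.card_pos.ne'
  have hc : (Nat.card {x : Fin 2 → F // x ≠ 0} : ℝ) = (Nat.card F : ℝ) ^ 2 - 1 := by
    have := Fintype.ofFinite F
    classical
    rw [Nat.card_eq_fintype_card, Fintype.card_subtype_compl, Fintype.card_subtype_eq,
      Nat.cast_sub Fintype.card_pos]
    simp
  rw [unitSumSqDensity, Nat.card_congr (Equiv.subtypeEquivRight hz), hc]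
  field_simp

/-- The quaternion norm form is split: a solution of a² + b² = -1 yields a linear bijection onto 2 ×
2 matrices carrying the sum of four squares to the determinant. The count is therefore the order of
GL₂, namely (q² - 1)(q² - q). -/
lemma unitSumSqDensity_four {F : Type*} [Field F] [Fintype F] (h2 : (2 : F) ≠ 0) {a b : F}
    (hab : a ^ 2 + b ^ 2 = -1) : unitSumSqDensity 4 F =
      (1 - 1 / (Nat.card F : ℝ)) * (1 - 1 / (Nat.card F : ℝ) ^ 2) := by
  let e : (Fin 4 → F) ≃ Matrix (Fin 2) (Fin 2) F :=
    { toFun x := !![x 0 + a * x 2 - b * x 3, -x 1 + b * x 2 + a * x 3;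
        x 1 + b * x 2 + a * x 3, x 0 - a * x 2 + b * x 3]
      invFun M := ![(M 0 0 + M 1 1) / 2, (M 1 0 - M 0 1) / 2,
        -(a * (M 0 0 - M 1 1) + b * (M 0 1 + M 1 0)) / 2,
        -(-b * (M 0 0 - M 1 1) + a * (M 0 1 + M 1 0)) / 2]
      left_inv x := by
        ext j
        fin_cases j <;> simp <;> field_simp
        · ring
        · ring
        · linear_combination (-2 * x 2) * hab
        · linear_combination (-2 * x 3) * hab
      right_inv M := by
        ext i j
        fin_cases i <;> fin_cases j <;> simp <;> field_simp
        · linear_combination (-(M 0 0 - M 1 1)) * hab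
        · linear_combination (-(M 0 1 + M 1 0)) * hab
        · linear_combination (-(M 0 1 + M 1 0)) * hab
        · linear_combination (M 0 0 - M 1 1) * hab }
  have hdet : ∀ x, (e x).det = ∑ j, x j ^ 2 := by
    intro x
    simp only [e, Equiv.coe_fn_mk, Matrix.det_fin_two_of, Fin.sum_univ_four]
    linear_combination (-x 2 ^ 2 - x 3 ^ 2) * hab
  have e' : {x : Fin 4 → F // IsUnit (∑ j, x j ^ 2)} ≃ Matrix.GeneralLinearGroup (Fin 2) F :=
    (e.subtypeEquiv (q := fun M ↦ IsUnit M) fun x ↦ by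
      rw [Matrix.isUnit_iff_isUnit_det, hdet]).trans
    Submonoid.unitsTypeEquivIsUnitSubmonoid.symm.toEquiv
  have hF : (Nat.card F : ℝ) ≠ 0 := by exact_mod_cast Nat.card_pos.ne'
  rw [unitSumSqDensity, Nat.card_congr e', Matrix.card_GL_field, Fin.prod_univ_two,
    ← Nat.card_eq_fintype_card]
  have h1 : 1 ≤ Nat.card F := Nat.card_pos
  rw [Nat.cast_mul, Nat.cast_sub (Nat.pow_le_pow_right h1 (by simp)),
    Nat.cast_sub (Nat.pow_le_pow_right h1 (by simp))]
  push_cast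
  simp
  field_simp

/-! ### Squarefree-supported multiplicative functions and their Euler products -/

/-- The arithmetic function supported on squarefree numbers with value `∏ p ∣ d, g p` at `d`. -/
noncomputable def sqfreeProd (g : ℕ → ℝ) : ArithmeticFunction ℝ :=
  ⟨fun d ↦ if Squarefree d then ∏ p ∈ d.primeFactors, g p else 0, by simp⟩

lemma sqfreeProd_apply (g : ℕ → ℝ) (d : ℕ) :
    sqfreeProd g d = if Squarefree d then ∏ p ∈ d.primeFactors, g p else 0 := rfl

lemma isMultiplicative_sqfreeProd (g : ℕ → ℝ) : (sqfreeProd g).IsMultiplicative := by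
  refine ⟨by simp [sqfreeProd_apply], fun {m n} hmn ↦ ?_⟩
  simp only [sqfreeProd_apply, Nat.squarefree_mul hmn, hmn.primeFactors_mul,
    Finset.prod_union hmn.disjoint_primeFactors]
  split_ifs <;> simp_all

lemma sqfreeProd_prime (g : ℕ → ℝ) {p : ℕ} (hp : p.Prime) : sqfreeProd g p = g p := by
  simp [sqfreeProd_apply, hp.prime.squarefree, hp.primeFactors]

lemma sqfreeProd_prime_pow (g : ℕ → ℝ) {p : ℕ} (hp : p.Prime) {e : ℕ} (he : 2 ≤ e) :
    sqfreeProd g (p ^ e) = 0 := by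
  rw [sqfreeProd_apply, if_neg]
  rw [Nat.squarefree_pow_iff hp.ne_one (by omega)]
  omega

/-- Both sides are multiplicative, and at a prime power only the divisors 1 and p contribute. -/
lemma sum_divisors_sqfreeProd (g : ℕ → ℝ) {n : ℕ} (hn : n ≠ 0) :
    ∑ d ∈ n.divisors, sqfreeProd g d = ∏ p ∈ n.primeFactors, (1 + g p) := by
  have hm : (sqfreeProd g * (ArithmeticFunction.zeta : ArithmeticFunction ℝ)).IsMultiplicative :=
    (isMultiplicative_sqfreeProd g).mul ArithmeticFunction.isMultiplicative_zeta.natCast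
  induction n using Nat.recOnPosPrimePosCoprime with
  | zero => simp at hn
  | one => simp [sqfreeProd_apply]
  | prime_pow p a hp ha =>
    obtain ⟨b, rfl⟩ := Nat.exists_eq_add_of_le' ha
    rw [Nat.primeFactors_prime_pow ha.ne' hp, Nat.sum_divisors_prime_pow hp,
      Finset.prod_singleton, Finset.sum_range_succ', Finset.sum_range_succ',
      Finset.sum_eq_zero fun i _ ↦ sqfreeProd_prime_pow g hp (by omega)]
    simp [sqfreeProd_prime g hp, (isMultiplicative_sqfreeProd g).map_one, add_comm]
  | coprime a b ha hb hab iha ihb =>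
    rw [← ArithmeticFunction.coe_mul_zeta_apply, hm.map_mul_of_coprime hab,
      ArithmeticFunction.coe_mul_zeta_apply, ArithmeticFunction.coe_mul_zeta_apply,
      iha (by omega), ihb (by omega), hab.primeFactors_mul,
      Finset.prod_union hab.disjoint_primeFactors]

/-- Squarefree support makes a comparison at primes enough; elsewhere nonnegativity of `h` suffices.
-/
lemma abs_sqfreeProd_le {g : ℕ → ℝ} {h : ArithmeticFunction ℝ} (hm : h.IsMultiplicative)
    (h0 : ∀ n, 0 ≤ h n) (hgh : ∀ p : ℕ, p.Prime → |g p| ≤ h p) (d : ℕ) :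
    |sqfreeProd g d| ≤ h d := by
  rw [sqfreeProd_apply]
  split_ifs with hd
  · rw [Finset.abs_prod]
    conv_rhs => rw [← Nat.prod_primeFactors_of_squarefree hd]
    rw [hm.map_prod_of_subset_primeFactors d _ subset_rfl]
    exact Finset.prod_le_prod (fun _ _ ↦ abs_nonneg _)
      fun p hp ↦ hgh p (Nat.prime_of_mem_primeFactors hp)
  · simpa using h0 d

lemma hasProd_sqfreeProd_div {g : ℕ → ℝ} (hs : Summable fun d : ℕ ↦ |sqfreeProd g d| / d) :
    HasProd (fun p : Nat.Primes ↦ 1 + g p / p) (∑' d : ℕ, sqfreeProd g d / d) := by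
  have hm := isMultiplicative_sqfreeProd g
  have := EulerProduct.eulerProduct_hasProd (f := fun d : ℕ ↦ sqfreeProd g d / d)
    (by simp [hm.map_one])
    (fun {m n} hmn ↦ by
      rw [hm.map_mul_of_coprime hmn, Nat.cast_mul, mul_div_mul_comm])
    (hs.congr fun d ↦ by simp) (by simp)
  have heq : (fun p : Nat.Primes ↦ ∑' e, sqfreeProd g (p ^ e) / (p ^ e : ℕ)) =
      fun p : Nat.Primes ↦ 1 + g p / p := by
    funext p
    rw [tsum_eq_sum (s := Finset.range 2), Finset.sum_range_succ, Finset.sum_range_one]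
    · simp [hm.map_one, sqfreeProd_prime g p.2]
    · intro e he
      rw [sqfreeProd_prime_pow g p.2 (by simp at he; omega), zero_div]
  rwa [heq] at this

/-! ### Majorants with logarithmically growing partial sums -/

lemma ArithmeticFunction.mul_apply_prime (f g : ArithmeticFunction ℝ) {p : ℕ} (hp : p.Prime) :
    (f * g) p = f 1 * g p + f p * g 1 := by
  rw [ArithmeticFunction.mul_apply, Nat.sum_divisorsAntidiagonal (f := fun a b ↦ f a * g b),
    hp.sum_divisors, Nat.div_self hp.pos, Nat.div_one, add_comm]

/-- Only the partial sums of `g` are bounded, so `g` may change sign; this is what admits χ₄. -/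
lemma ArithmeticFunction.sum_mul_le {f g : ArithmeticFunction ℝ} (hf : ∀ n, 0 ≤ f n) {c : ℝ}
    (hg : ∀ M, ∑ m ∈ Finset.Ioc 0 M, g m ≤ c) (N : ℕ) :
    ∑ n ∈ Finset.Ioc 0 N, (f * g) n ≤ c * ∑ n ∈ Finset.Ioc 0 N, f n := by
  rw [ArithmeticFunction.sum_Ioc_mul_eq_sum_sum, Finset.mul_sum]
  refine Finset.sum_le_sum fun n _ ↦ ?_
  rw [mul_comm]
  exact mul_le_mul_of_nonneg_right (hg _) (hf n)

/-- The arithmetic function `n ↦ 1 / n ^ j` for `j ≠ 0`. -/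
noncomputable def invPow (j : ℕ) : ArithmeticFunction ℝ :=
  ⟨fun n ↦ if n = 0 then 0 else ((n : ℝ) ^ j)⁻¹, by simp⟩

lemma invPow_apply (j : ℕ) {n : ℕ} (hn : n ≠ 0) : invPow j n = ((n : ℝ) ^ j)⁻¹ := by
  simp [invPow, hn]

lemma invPow_nonneg (j n : ℕ) : 0 ≤ invPow j n := by
  simp only [invPow, ArithmeticFunction.coe_mk]
  split_ifs <;> positivity

lemma isMultiplicative_invPow (j : ℕ) : (invPow j).IsMultiplicative := by
  rw [ArithmeticFunction.IsMultiplicative.iff_ne_zero]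
  refine ⟨by simp [invPow_apply], fun {m n} hm hn _ ↦ ?_⟩
  rw [invPow_apply j hm, invPow_apply j hn, invPow_apply j (mul_ne_zero hm hn), Nat.cast_mul,
    mul_pow, mul_inv]

lemma sum_invPow_one_le (N : ℕ) : ∑ n ∈ Finset.Ioc 0 N, invPow 1 n ≤ 1 + Real.log N := by
  refine le_trans (le_of_eq ?_) (harmonic_le_one_add_log N)
  rw [harmonic_eq_sum_Icc, Rat.cast_sum]
  refine Finset.sum_congr (by ext; simp; omega) fun n hn ↦ ?_
  rw [invPow_apply 1 (by simp at hn; omega)]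
  simp

lemma sum_invPow_two_le (N : ℕ) : ∑ n ∈ Finset.Ioc 0 N, invPow 2 n ≤ 2 := by
  -- The extra term makes the induction telescope. As the inverse of 0 is 0, the step from 0 to 1 is
  -- separate.
  have : ∑ n ∈ Finset.Ioc 0 N, invPow 2 n ≤ 2 - (N : ℝ)⁻¹ := by
    induction N with
    | zero => simp
    | succ N ih =>
      rw [Finset.sum_Ioc_succ_top (Nat.zero_le N), invPow_apply 2 (Nat.succ_ne_zero N)]
      rcases Nat.eq_zero_or_pos N with rfl | hN
      · norm_num
      · have hN' : (0 : ℝ) < N := by exact_mod_cast hN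
        have : (((N + 1 : ℕ) : ℝ) ^ 2)⁻¹ ≤ (N : ℝ)⁻¹ - ((N + 1 : ℕ) : ℝ)⁻¹ := by
          push_cast
          rw [inv_sub_inv (by positivity) (by positivity), inv_eq_one_div,
            div_le_div_iff₀ (by positivity) (by positivity)]
          nlinarith
        linarith
  exact this.trans (by simp)

lemma invPow_mul_nonneg (n : ℕ) : 0 ≤ (invPow 1 * invPow 2) n := by
  rw [ArithmeticFunction.mul_apply]
  exact Finset.sum_nonneg fun _ _ ↦ mul_nonneg (invPow_nonneg _ _) (invPow_nonneg _ _)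

lemma sum_invPow_mul_le (N : ℕ) :
    ∑ n ∈ Finset.Ioc 0 N, (invPow 1 * invPow 2) n ≤ 2 * (1 + Real.log N) :=
  (ArithmeticFunction.sum_mul_le (invPow_nonneg 1) sum_invPow_two_le N).trans
    (mul_le_mul_of_nonneg_left (sum_invPow_one_le N) (by norm_num))

/-- The arithmetic function `n ↦ χ₄ n / n`. -/
noncomputable def chiFourDiv : ArithmeticFunction ℝ :=
  ⟨fun n ↦ (ZMod.χ₄ (n : ZMod 4) : ℝ) / n, by simp⟩

lemma chiFourDiv_apply (n : ℕ) : chiFourDiv n = (ZMod.χ₄ (n : ZMod 4) : ℝ) / n := rfl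

lemma isMultiplicative_chiFourDiv : chiFourDiv.IsMultiplicative := by
  refine ⟨by simp [chiFourDiv_apply], fun {m n} _ ↦ ?_⟩
  rw [chiFourDiv_apply, chiFourDiv_apply, chiFourDiv_apply, Nat.cast_mul, Nat.cast_mul, map_mul,
    Int.cast_mul, mul_div_mul_comm]

lemma sum_chiFourDiv_le (N : ℕ) : ∑ n ∈ Finset.Ioc 0 N, chiFourDiv n ≤ 1 := by
  have v1 : ∀ m : ℕ, chiFourDiv (4 * m + 1) = 1 / (4 * m + 1) := fun m ↦ by
    rw [chiFourDiv_apply, ZMod.χ₄_nat_one_mod_four (by omega)]; push_cast; rfl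
  have v2 : ∀ m : ℕ, chiFourDiv (4 * m + 1 + 1) = 0 := fun m ↦ by
    rw [chiFourDiv_apply, ZMod.χ₄_nat_eq_if_mod_four, if_pos (by omega)]; simp
  have v3 : ∀ m : ℕ, chiFourDiv (4 * m + 1 + 1 + 1) = -(1 / (4 * m + 3)) := fun m ↦ by
    rw [chiFourDiv_apply, ZMod.χ₄_nat_three_mod_four (by omega)]; push_cast; ring
  have v4 : ∀ m : ℕ, chiFourDiv (4 * m + 1 + 1 + 1 + 1) = 0 := fun m ↦ by
    rw [chiFourDiv_apply, ZMod.χ₄_nat_eq_if_mod_four, if_pos (by omega)]; simp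
  have hs := fun n ↦ Finset.sum_Ioc_succ_top (f := chiFourDiv) (Nat.zero_le n)
  -- Over a full period, 1/(4m+1) - 1/(4m+3) ≤ 1/(4m+1) - 1/(4m+5), which telescopes. The slack
  -- 1/(4m+1) pays for the one positive term of an incomplete period.
  have h4 : ∀ m : ℕ, ∑ n ∈ Finset.Ioc 0 (4 * m), chiFourDiv n ≤ 1 - 1 / (4 * m + 1) := by
    intro m
    induction m with
    | zero => simp
    | succ m ih =>
      rw [show 4 * (m + 1) = 4 * m + 1 + 1 + 1 + 1 by ring, hs, hs, hs, hs, v1, v2, v3, v4]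
      have : (1 : ℝ) / (4 * (m + 1 : ℕ) + 1) ≤ 1 / (4 * m + 3) := by
        push_cast
        exact one_div_le_one_div_of_le (by positivity) (by linarith)
      linarith
  have hN : N = 4 * (N / 4) + N % 4 := by omega
  have hlt : N % 4 < 4 := Nat.mod_lt _ (by norm_num)
  have := h4 (N / 4)
  have p1 : (0 : ℝ) ≤ 1 / (4 * (N / 4 : ℕ) + 1) := by positivity
  have p3 : (0 : ℝ) ≤ 1 / (4 * (N / 4 : ℕ) + 3) := by positivity
  generalize N / 4 = m at *
  generalize N % 4 = r at *
  subst hN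
  interval_cases r
  · rw [add_zero]; linarith
  · rw [hs, v1]; linarith
  · rw [show 4 * m + 2 = 4 * m + 1 + 1 by ring, hs, hs, v1, v2]; linarith
  · rw [show 4 * m + 3 = 4 * m + 1 + 1 + 1 by ring, hs, hs, hs, v1, v2, v3]; linarith

/-- Up to the factor 1/n this is ∑_{d ∣ n} χ₄(d). At a prime power that sum is a geometric sum of
ratio 0, 1 or -1, hence nonnegative. -/
lemma chiFourDiv_mul_invPow_nonneg (n : ℕ) : 0 ≤ (chiFourDiv * invPow 1) n := by
  rcases eq_or_ne n 0 with rfl | hn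
  · simp
  rw [(isMultiplicative_chiFourDiv.mul (isMultiplicative_invPow 1)).multiplicative_factorization _
    hn]
  refine Finset.prod_nonneg fun p hp ↦ ?_
  have hp : p.Prime := Nat.prime_of_mem_primeFactors hp
  generalize n.factorization p = k
  have hp0 : (0 : ℝ) < p := by exact_mod_cast hp.pos
  have : (chiFourDiv * invPow 1) (p ^ k) =
      (∑ i ∈ Finset.range (k + 1), (ZMod.χ₄ (p : ZMod 4) : ℝ) ^ i) / p ^ k := by
    rw [ArithmeticFunction.mul_apply,
      Nat.sum_divisorsAntidiagonal (f := fun a b ↦ chiFourDiv a * invPow 1 b),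
      Nat.sum_divisors_prime_pow hp, Finset.sum_div]
    refine Finset.sum_congr rfl fun i hi ↦ ?_
    have hik : i ≤ k := Nat.lt_succ_iff.1 (Finset.mem_range.1 hi)
    rw [Nat.pow_div hik hp.pos, invPow_apply 1 (pow_ne_zero _ hp.ne_zero), chiFourDiv_apply,
      Nat.cast_pow, map_pow]
    push_cast
    rw [pow_one, ← div_eq_mul_inv, div_div, ← pow_add, Nat.add_sub_cancel' hik]
  change 0 ≤ (chiFourDiv * invPow 1) (p ^ k)
  rw [this]
  refine div_nonneg ?_ (by positivity)
  rcases ZMod.isQuadratic_χ₄ p with h | h | h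
  · rw [h]; exact Finset.sum_nonneg fun i _ ↦ by positivity
  · rw [h]; exact Finset.sum_nonneg fun i _ ↦ by positivity
  · rw [h, Int.cast_neg, Int.cast_one, neg_one_geom_sum]
    split_ifs <;> norm_num

lemma invPow_mul_chiFourDiv_nonneg (n : ℕ) : 0 ≤ (invPow 1 * invPow 2 * chiFourDiv) n := by
  rw [show invPow 1 * invPow 2 * chiFourDiv = chiFourDiv * invPow 1 * invPow 2 by ring,
    ArithmeticFunction.mul_apply]
  exact Finset.sum_nonneg fun _ _ ↦
    mul_nonneg (chiFourDiv_mul_invPow_nonneg _) (invPow_nonneg _ _)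

/-- The grouping differs from the one used for nonnegativity: here χ₄(n)/n is the signed factor with
bounded partial sums. -/
lemma sum_invPow_mul_chiFourDiv_le (N : ℕ) :
    ∑ n ∈ Finset.Ioc 0 N, (invPow 1 * invPow 2 * chiFourDiv) n ≤ 2 * (1 + Real.log N) :=
  (ArithmeticFunction.sum_mul_le invPow_mul_nonneg sum_chiFourDiv_le N).trans
    (by simpa using sum_invPow_mul_le N)

/-! ### Densities at odd primes and the mean value as an Euler product -/

lemma unitSumSqDensity_two_of_mod_four_eq_one {p : ℕ} (hp : p.Prime) (h : p % 4 = 1) :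
    unitSumSqDensity 2 (ZMod p) = (1 - 1 / (p : ℝ)) ^ 2 := by
  have : Fact p.Prime := ⟨hp⟩
  have h2 : (2 : ZMod p) ≠ 0 := Ring.two_ne_zero (by rw [ZMod.ringChar_zmod_n]; omega)
  simpa using unitSumSqDensity_two_of_isSquare h2 (ZMod.exists_sq_eq_neg_one_iff.2 (by omega))

lemma unitSumSqDensity_two_of_mod_four_eq_three {p : ℕ} (hp : p.Prime) (h : p % 4 = 3) :
    unitSumSqDensity 2 (ZMod p) = 1 - 1 / (p : ℝ) ^ 2 := by
  have : Fact p.Prime := ⟨hp⟩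
  simpa using unitSumSqDensity_two_of_not_isSquare (F := ZMod p)
    (fun hsq ↦ ZMod.exists_sq_eq_neg_one_iff.1 hsq h)

lemma unitSumSqDensity_four_of_two_lt {p : ℕ} (hp : p.Prime) (h : 2 < p) :
    unitSumSqDensity 4 (ZMod p) = (1 - 1 / (p : ℝ)) * (1 - 1 / (p : ℝ) ^ 2) := by
  have : Fact p.Prime := ⟨hp⟩
  have h2 : (2 : ZMod p) ≠ 0 := Ring.two_ne_zero (by rw [ZMod.ringChar_zmod_n]; omega)
  obtain ⟨a, b, hab⟩ := ZMod.sq_add_sq p (-1)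
  simpa using unitSumSqDensity_four h2 hab

/-- The mean value of `n ^ k * unitSumSqDensity k (ZMod n)` as an Euler product, for a
multiplicative majorant `h` with logarithmically growing partial sums. -/
theorem sumSqTotient_mean_value (k : ℕ) {h : ArithmeticFunction ℝ} {C : ℝ}
    (hm : h.IsMultiplicative) (h0 : ∀ n, 0 ≤ h n)
    (hle : ∀ p : ℕ, p.Prime → |unitSumSqDensity k (ZMod p) - 1| ≤ h p)
    (hsum : ∀ N : ℕ, ∑ n ∈ Finset.Ioc 0 N, h n ≤ C * (1 + Real.log N)) :
    (Summable fun p : {p : ℕ | p.Prime} ↦ (unitSumSqDensity k (ZMod p) - 1) / (p : ℝ)) ∧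
    (fun x : ℝ ↦ (∑ n ∈ Finset.Icc 1 ⌊x⌋₊, (sumSqTotient k n : ℝ)) - x ^ (k + 1) / (k + 1) *
      ∏' p : {p : ℕ | p.Prime}, (1 + (unitSumSqDensity k (ZMod p) - 1) / (p : ℝ)))
      =O[atTop] (fun x : ℝ ↦ x ^ k * Real.log x) := by
  set g : ℕ → ℝ := fun p ↦ unitSumSqDensity k (ZMod p) - 1 with hg
  have hC : ∀ N : ℕ, 1 ≤ N →
      ∑ d ∈ Finset.Ioc 0 N, |sqfreeProd g d| ≤ C * (1 + Real.log N) := fun N _ ↦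
    (Finset.sum_le_sum fun d _ ↦ abs_sqfreeProd_le hm h0 hle d).trans (hsum N)
  have hs := summable_abs_div_of_sum_le hC
  constructor
  · refine Summable.of_norm (((hs.subtype {p : ℕ | p.Prime})).congr fun p ↦ ?_)
    rw [Real.norm_eq_abs, abs_div, Nat.abs_cast, Function.comp_apply, sqfreeProd_prime g p.2]
  · have hprod : ∏' p : {p : ℕ | p.Prime}, (1 + (unitSumSqDensity k (ZMod p) - 1) / (p : ℝ)) =
        ∑' d : ℕ, sqfreeProd g d / d := (hasProd_sqfreeProd_div hs).tprod_eq
    refine (sum_pow_mul_sum_divisors_isBigO k hC).congr_left fun x ↦ ?_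
    rw [hprod]
    congr 1
    refine Finset.sum_congr rfl fun n hn ↦ ?_
    have hn0 : n ≠ 0 := by simp at hn; omega
    rw [sumSqTotient_eq k hn0, sum_divisors_sqfreeProd g hn0, unitSumSqDensity_zmod k hn0]
    simp [hg]

/-! ### Splitting the Euler product by residue classes -/

lemma multipliable_subtype_one_add {s t : Set ℕ} (hst : s ⊆ t) {u : ℕ → ℝ}
    (hu : Summable fun p : t ↦ u p) : Multipliable fun p : s ↦ 1 + u p :=
  Real.multipliable_one_add_of_summable
    (hu.comp_injective (i := Set.inclusion hst) (Set.inclusion_injective hst))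

lemma tprod_union_one_add {s t r : Set ℕ} (hst : s ∪ t = r) (hd : Disjoint s t) {u : ℕ → ℝ}
    (hu : Summable fun p : r ↦ u p) :
    ∏' p : r, (1 + u p) = (∏' p : s, (1 + u p)) * ∏' p : t, (1 + u p) := by
  subst hst
  exact Multipliable.tprod_union_disjoint (f := fun p ↦ 1 + u p) hd
    (multipliable_subtype_one_add Set.subset_union_left hu)
    (multipliable_subtype_one_add Set.subset_union_right hu)

lemma tprod_primes_one_add {u : ℕ → ℝ} (hu : Summable fun p : {p : ℕ | p.Prime} ↦ u p) :
    ∏' p : {p : ℕ | p.Prime}, (1 + u p) =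
      (1 + u 2) * ∏' p : {p : ℕ | p.Prime ∧ 2 < p}, (1 + u p) := by
  have htwo : {2} ∪ {p : ℕ | p.Prime ∧ 2 < p} = {p : ℕ | p.Prime} := by
    ext p
    simp only [Set.mem_union, Set.mem_singleton_iff, Set.mem_ofPred_eq]
    refine ⟨?_, fun hp ↦ (hp.two_le.eq_or_lt).imp Eq.symm fun h ↦ ⟨hp, h⟩⟩
    rintro (rfl | h)
    exacts [Nat.prime_two, h.1]
  rw [tprod_union_one_add htwo (by simp) hu, tprod_singleton (f := fun p ↦ 1 + u p)]

/-! ### Comparison with the majorants at primes, and the two asymptotics -/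

lemma invPow_mul_apply_prime {p : ℕ} (hp : p.Prime) :
    (invPow 1 * invPow 2) p = 1 / (p : ℝ) + 1 / (p : ℝ) ^ 2 := by
  rw [ArithmeticFunction.mul_apply_prime _ _ hp, invPow_apply 1 hp.ne_zero,
    invPow_apply 2 hp.ne_zero, invPow_apply 1 one_ne_zero, invPow_apply 2 one_ne_zero]
  simp [add_comm]

lemma invPow_mul_chiFourDiv_apply_prime {p : ℕ} (hp : p.Prime) :
    (invPow 1 * invPow 2 * chiFourDiv) p =
      (1 + ZMod.χ₄ (p : ZMod 4)) / (p : ℝ) + 1 / (p : ℝ) ^ 2 := by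
  rw [ArithmeticFunction.mul_apply_prime _ _ hp, invPow_mul_apply_prime hp,
    ((isMultiplicative_invPow 1).mul (isMultiplicative_invPow 2)).map_one,
    isMultiplicative_chiFourDiv.map_one, chiFourDiv_apply]
  ring

/-- The left side is 1/2, 2/p - 1/p² or 1/p² for p = 2, p ≡ 1 or p ≡ 3 mod 4; the right side is 3/4,
2/p + 1/p² or 1/p². -/
lemma abs_unitSumSqDensity_two_sub_one_le {p : ℕ} (hp : p.Prime) :
    |unitSumSqDensity 2 (ZMod p) - 1| ≤ (invPow 1 * invPow 2 * chiFourDiv) p := by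
  have hp0 : (0 : ℝ) < p := by exact_mod_cast hp.pos
  have h1 : 1 / (p : ℝ) ≤ 1 := by
    rw [div_le_one hp0]; exact_mod_cast hp.one_lt.le
  have h0 : 0 < 1 / (p : ℝ) := by positivity
  rw [invPow_mul_chiFourDiv_apply_prime hp]
  rcases hp.eq_two_or_odd with rfl | hodd
  · rw [unitSumSqDensity_two_zmod_two, ZMod.χ₄_nat_eq_if_mod_four]
    norm_num
  rcases (by omega : p % 4 = 1 ∨ p % 4 = 3) with h | h
  · rw [unitSumSqDensity_two_of_mod_four_eq_one hp h, ZMod.χ₄_nat_one_mod_four h, abs_le]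
    have e : (1 + ((1 : ℤ) : ℝ)) / p + 1 / (p : ℝ) ^ 2 = 2 * (1 / p) + (1 / (p : ℝ)) ^ 2 := by
      push_cast; ring
    rw [e]
    constructor <;> nlinarith
  · rw [unitSumSqDensity_two_of_mod_four_eq_three hp h, ZMod.χ₄_nat_three_mod_four h]
    simp

lemma abs_unitSumSqDensity_four_sub_one_le {p : ℕ} (hp : p.Prime) :
    |unitSumSqDensity 4 (ZMod p) - 1| ≤ (invPow 1 * invPow 2) p := by
  have hp0 : (0 : ℝ) < p := by exact_mod_cast hp.pos
  have h1 : 1 / (p : ℝ) ≤ 1 := by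
    rw [div_le_one hp0]; exact_mod_cast hp.one_lt.le
  have h0 : 0 < 1 / (p : ℝ) := by positivity
  rw [invPow_mul_apply_prime hp]
  rcases hp.two_le.eq_or_lt with rfl | h
  · rw [unitSumSqDensity_four_zmod_two]
    norm_num
  · rw [unitSumSqDensity_four_of_two_lt hp h, ← one_div_pow]
    have h2 : 0 ≤ (1 / (p : ℝ)) ^ 2 * (1 - 1 / p) := by
      have : 0 ≤ 1 - 1 / (p : ℝ) := by linarith
      positivity
    have h3 : 0 < (1 / (p : ℝ)) ^ 3 := by positivity
    rw [abs_le]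
    constructor <;> nlinarith

theorem mainTheorem4 :
    (Multipliable (fun p : {p : ℕ // p.Prime ∧ p % 4 = 1} ↦
        1 - 2 / (p : ℝ) ^ 2 + 1 / (p : ℝ) ^ 3) ∧
      Multipliable (fun p : {p : ℕ // p.Prime ∧ p % 4 = 3} ↦ 1 - 1 / (p : ℝ) ^ 3) ∧
      (fun x : ℝ ↦ (∑ n ∈ Finset.Icc 1 ⌊x⌋₊, (sumSqTotient 2 n : ℝ)) -
          x ^ 3 / 4 *
            (∏' p : {p : ℕ // p.Prime ∧ p % 4 = 1},
              (1 - 2 / (p : ℝ) ^ 2 + 1 / (p : ℝ) ^ 3)) *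
            (∏' p : {p : ℕ // p.Prime ∧ p % 4 = 3}, (1 - 1 / (p : ℝ) ^ 3)))
        =O[atTop] (fun x : ℝ ↦ x ^ 2 * Real.log x)) ∧
    (Multipliable (fun p : {p : ℕ // p.Prime ∧ 2 < p} ↦
        1 - 1 / (p : ℝ) ^ 2 - 1 / (p : ℝ) ^ 3 + 1 / (p : ℝ) ^ 4) ∧
      (fun x : ℝ ↦ (∑ n ∈ Finset.Icc 1 ⌊x⌋₊, (sumSqTotient 4 n : ℝ)) -
          3 * x ^ 5 / 20 *
            (∏' p : {p : ℕ // p.Prime ∧ 2 < p},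
              (1 - 1 / (p : ℝ) ^ 2 - 1 / (p : ℝ) ^ 3 + 1 / (p : ℝ) ^ 4)))
        =O[atTop] (fun x : ℝ ↦ x ^ 4 * Real.log x)) := by
  constructor
  · let u : ℕ → ℝ := fun p ↦ (unitSumSqDensity 2 (ZMod p) - 1) / p
    obtain ⟨hs : Summable fun p : {p : ℕ | p.Prime} ↦ u p, hO⟩ := sumSqTotient_mean_value 2
      (((isMultiplicative_invPow 1).mul (isMultiplicative_invPow 2)).mul
        isMultiplicative_chiFourDiv) invPow_mul_chiFourDiv_nonneg
      (fun _ ↦ abs_unitSumSqDensity_two_sub_one_le) sum_invPow_mul_chiFourDiv_le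
    have e1 : ∀ p : {p : ℕ | p.Prime ∧ p % 4 = 1},
        1 + u p = 1 - 2 / (p : ℝ) ^ 2 + 1 / (p : ℝ) ^ 3 := fun p ↦ by
      have := p.2.1.ne_zero
      simp only [u, unitSumSqDensity_two_of_mod_four_eq_one p.2.1 p.2.2]
      field_simp
      ring
    have e3 : ∀ p : {p : ℕ | p.Prime ∧ p % 4 = 3}, 1 + u p = 1 - 1 / (p : ℝ) ^ 3 := fun p ↦ by
      have := p.2.1.ne_zero
      simp only [u, unitSumSqDensity_two_of_mod_four_eq_three p.2.1 p.2.2]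
      field_simp
      ring
    have m1 := multipliable_subtype_one_add (s := {p : ℕ | p.Prime ∧ p % 4 = 1}) (u := u)
      (fun _ h ↦ h.1) hs
    have m3 := multipliable_subtype_one_add (s := {p : ℕ | p.Prime ∧ p % 4 = 3}) (u := u)
      (fun _ h ↦ h.1) hs
    refine ⟨m1.congr e1, m3.congr e3, hO.congr_left fun x ↦ ?_⟩
    have hodd : {p : ℕ | p.Prime ∧ p % 4 = 1} ∪ {p : ℕ | p.Prime ∧ p % 4 = 3} =
        {p : ℕ | p.Prime ∧ 2 < p} := by
      ext p
      simp only [Set.mem_union, Set.mem_ofPred_eq, ← and_or_left]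
      refine and_congr_right fun hp ↦ ?_
      rcases hp.eq_two_or_odd with rfl | h
      · simp
      · have := hp.two_le
        omega
    have hs' : Summable fun p : {p : ℕ | p.Prime ∧ 2 < p} ↦ u p :=
      hs.comp_injective (i := Set.inclusion fun _ h ↦ h.1) (Set.inclusion_injective _)
    have hdisj : Disjoint {p : ℕ | p.Prime ∧ p % 4 = 1} {p : ℕ | p.Prime ∧ p % 4 = 3} :=
      Set.disjoint_left.2 fun p h h' ↦ by have := h.2.symm.trans h'.2; omega
    have hsplit := (tprod_primes_one_add (u := u) hs).trans
      (congrArg ((1 + u 2) * ·) ((tprod_union_one_add (u := u) hodd hdisj hs').trans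
        (congrArg₂ (· * ·) (tprod_congr e1) (tprod_congr e3))))
    rw [hsplit]
    -- The Euler factor at 2 is 1 + (1/2 - 1)/2 = 3/4, which turns x³/3 into x³/4.
    simp only [u, unitSumSqDensity_two_zmod_two]
    push_cast
    ring_nf
    rfl
  · let u : ℕ → ℝ := fun p ↦ (unitSumSqDensity 4 (ZMod p) - 1) / p
    obtain ⟨hs : Summable fun p : {p : ℕ | p.Prime} ↦ u p, hO⟩ := sumSqTotient_mean_value 4
      ((isMultiplicative_invPow 1).mul (isMultiplicative_invPow 2)) invPow_mul_nonneg
      (fun _ ↦ abs_unitSumSqDensity_four_sub_one_le) sum_invPow_mul_le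
    have e : ∀ p : {p : ℕ | p.Prime ∧ 2 < p},
        1 + u p = 1 - 1 / (p : ℝ) ^ 2 - 1 / (p : ℝ) ^ 3 + 1 / (p : ℝ) ^ 4 := fun p ↦ by
      have := p.2.1.ne_zero
      simp only [u, unitSumSqDensity_four_of_two_lt p.2.1 p.2.2]
      field_simp
      ring
    have m := multipliable_subtype_one_add (s := {p : ℕ | p.Prime ∧ 2 < p}) (u := u)
      (fun _ h ↦ h.1) hs
    refine ⟨m.congr e, hO.congr_left fun x ↦ ?_⟩
    have hsplit := (tprod_primes_one_add (u := u) hs).trans (congrArg ((1 + u 2) * ·) (tprod_congr e))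
    rw [hsplit]
    -- Again the factor at 2 is 3/4, turning x⁵/5 into 3x⁵/20.
    simp only [u, unitSumSqDensity_four_zmod_two]
    push_cast
    ring_nf
    rfl
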